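/- Let $d\ge 1$ and write $\mathbb{R}^d_+=(0,\infty)^d$. For $\alpha\in(-1,\infty)^d$ put $|\alpha|=\alpha_1+\dots+\alpha_d$ and $\mu_\alpha(dx)=x_1^{2\alpha_1+1}\cdots x_d^{2\alpha_d+1}\,dx$ on $\mathbb{R}^d_+$. For $k\in\mathbb{N}^d$ (with $0\in\mathbb{N}$, $|k|=k_1+\dots+k_d$) let $$\ell_k^\alpha(x)=\prod_{i=1}^d\Big(\frac{2\,\Gamma(k_i+1)}{\Gamma(k_i+\alpha_i+1)}\Big)^{1/2}L_{k_i}^{\alpha_i}(x_i^2)\,e^{-x_i^2/2},\qquad x\in\mathbb{R}^d_+,$$ where $L_n^a$ is the Laguerre polynomial of degree $n$ and order $a$. For $t,\sigma>0$ and $x,y\in\mathbb{R}^d_+$ define the Laguerre heat kernel, the potential kernel and the potential operator by $$G_t^\alpha(x,y)=\sum_{n=0}^\infty e^{-t(4n+2|\alpha|+2d)}\sum_{|k|=n}\ell_k^\alpha(x)\ell_k^\alpha(y),\qquad \mathcal{K}^{\alpha,\sigma}(x,y)=\frac1{\Gamma(\sigma)}\int_0^\infty G_t^\alpha(x,y)\,t^{\sigma-1}\,dt,$$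 $$\mathcal{I}^{\alpha,\sigma}f(x)=\int_{\mathbb{R}^d_+}\mathcal{K}^{\alpha,\sigma}(x,y)f(y)\,d\mu_\alpha(y)\qquad(f\ge 0\text{ measurable}),$$ where the last two integrals take values in $[0,\infty]$ (and $0\cdot\infty=0$). **Proposition.** Let $\beta,\gamma\in(-1,\infty)^d$, $\beta\ne\gamma$, $\sigma_1,\sigma_2>0$, $\lambda\in(0,1)$, and let $$\alpha=\lambda\beta+(1-\lambda)\gamma,\qquad \sigma=\lambda\sigma_1+(1-\lambda)\sigma_2 .$$ Then the series defining $G_t^\alpha(x,y)$, $G_t^\beta(x,y)$, $G_t^\gamma(x,y)$ converge and have positive sums for all $t>0$ and $x,y\in\mathbb{R}^d_+$, and there are constants $c,C>0$, depending only on $d,\beta,\gamma,\sigma_1,\sigma_2,\lambda$, such that the following hold. 1. For all $t>0$ and $x,y\in\mathbb{R}^d_+$, $$c\,\big(G_t^\beta(x,y)\big)^\lambda\big(G_t^\gamma(x,y)\big)^{1-\lambda}\le G_t^\alpha(x,y)\le C\,\big(G_t^\beta(x,y)\big)^\lambda\big(G_t^\gamma(x,y)\big)^{1-\lambda}.$$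 2. For all $x,y\in\mathbb{R}^d_+$, $$\mathcal{K}^{\alpha,\sigma}(x,y)\le C\,\big(\mathcal{K}^{\beta,\sigma_1}(x,y)\big)^\lambda\big(\mathcal{K}^{\gamma,\sigma_2}(x,y)\big)^{1-\lambda}.$$ 3. For all measurable $f_1,f_2\colon\mathbb{R}^d_+\to[0,\infty)$, with $f=f_1^\lambda f_2^{1-\lambda}$, and all $x\in\mathbb{R}^d_+$, $$\mathcal{I}^{\alpha,\sigma}f(x)\le C\,\big(\mathcal{I}^{\beta,\sigma_1}f_1(x)\big)^\lambda\big(\mathcal{I}^{\gamma,\sigma_2}f_2(x)\big)^{1-\lambda}.$$ -/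

import Mathlib

open MeasureTheory Set
open scoped ENNReal

namespace Laguerre

noncomputable section

/-- The open orthant `ℝ^d_+ = (0,∞)^d`. -/
def orthant (d : ℕ) : Set (Fin d → ℝ) := {x | ∀ i, 0 < x i}

/-- The Laguerre polynomial `L_k^a` of degree `k` and order `a > -1`, as a function on `ℝ`:
`L_k^a(u) = ∑_{j ≤ k} Γ(k+a+1) / (Γ(j+a+1) (k-j)!) * (-u)^j / j!`. -/
def polyL (a : ℝ) (k : ℕ) (u : ℝ) : ℝ :=
  ∑ j ∈ Finset.range (k + 1),
    Real.Gamma (k + a + 1) / (Real.Gamma (j + a + 1) * ((k - j).factorial : ℝ)) *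
      ((-u) ^ j / (j.factorial : ℝ))

/-- The one-dimensional Laguerre function of convolution type
`(2 Γ(k+1) / Γ(k+a+1))^{1/2} L_k^a(u^2) e^{-u^2/2}`. -/
def ell1 (a : ℝ) (k : ℕ) (u : ℝ) : ℝ :=
  Real.sqrt (2 * Real.Gamma (k + 1) / Real.Gamma (k + a + 1)) * polyL a k (u ^ 2) *
    Real.exp (-u ^ 2 / 2)

/-- The multi-dimensional Laguerre function `ℓ_k^α`, a tensor product. -/
def ell {d : ℕ} (α : Fin d → ℝ) (k : Fin d → ℕ) (x : Fin d → ℝ) : ℝ :=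
  ∏ i, ell1 (α i) (k i) (x i)

/-- The `n`-th term `e^{-t(4n + 2|α| + 2d)} ∑_{|k| = n} ℓ_k^α(x) ℓ_k^α(y)`
of the series for the heat kernel, where `|α| = ∑ i, α i`. -/
def heatTerm {d : ℕ} (α : Fin d → ℝ) (t : ℝ) (x y : Fin d → ℝ) (n : ℕ) : ℝ :=
  Real.exp (-t * (4 * n + 2 * (∑ i, α i) + 2 * d)) *
    ∑ k ∈ Finset.piAntidiag (Finset.univ : Finset (Fin d)) n, ell α k x * ell α k y

/-- The Laguerre heat kernel `G_t^α(x,y)`. -/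
def heatKernel {d : ℕ} (α : Fin d → ℝ) (t : ℝ) (x y : Fin d → ℝ) : ℝ :=
  ∑' n : ℕ, heatTerm α t x y n

/-- The potential kernel `K^{α,σ}(x,y) = Γ(σ)⁻¹ ∫_0^∞ G_t^α(x,y) t^{σ-1} dt`, with values in
`[0,∞]` (the heat kernel is positive; on the diagonal the integral may be `∞`). -/
def potentialKernel {d : ℕ} (α : Fin d → ℝ) (σ : ℝ) (x y : Fin d → ℝ) : ℝ≥0∞ :=
  ENNReal.ofReal (1 / Real.Gamma σ) *
    ∫⁻ t in Ioi (0 : ℝ), ENNReal.ofReal (heatKernel α t x y * t ^ (σ - 1))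

/-- The measure `μ_α(dx) = ∏ i, x_i^{2 α_i + 1} dx` on `ℝ^d_+` (regarded as a measure on `ℝ^d`
concentrated on `ℝ^d_+`). -/
def mu {d : ℕ} (α : Fin d → ℝ) : Measure (Fin d → ℝ) :=
  (volume.restrict (orthant d)).withDensity
    fun x => ENNReal.ofReal (∏ i, x i ^ (2 * α i + 1))

/-- The potential operator on nonnegative functions,
`I^{α,σ} f(x) = ∫ K^{α,σ}(x,y) f(y) dμ_α(y)`, with values in `[0,∞]`. -/
def potential {d : ℕ} (α : Fin d → ℝ) (σ : ℝ) (f : (Fin d → ℝ) → ℝ) (x : Fin d → ℝ) : ℝ≥0∞ :=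
  ∫⁻ y, potentialKernel α σ x y * ENNReal.ofReal (f y) ∂(mu α)

end

end Laguerre

namespace Laguerre

open scoped Nat Asymptotics
open Filter Asymptotics

/-! The Hille–Hardy formula (`hasSum_hilleHardy`) puts each one-dimensional heat kernel of order `a`
in the form `A ^ (a + 1) * B * besselSeries a w`, where `A`, `B` and `w ≥ 0` do not depend on `a`.
The first two factors are exactly log-linear in `a`, and the `d`-dimensional kernel is a product
over coordinates (`hasSum_heatTerm`), so part 1 reduces to the log-linearity of `besselSeries` in
its order, up to constants uniform in `w`.

Classically `besselSeries a w` has size `exp (2√w) (1 + √w) ^ (-a - 1/2)`. The proof avoids these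
asymptotics: it only shows that the functions `besselSeries a w * (1 + √w) ^ a`, for `a > -1`, are
pairwise comparable (`weightedBessel_isTheta`). Hölder's inequality on the series, a reverse
log-convexity of Gamma and the recurrence from `a` to `a + 1` and `a + 2` suffice. A geometric mean
of two such functions is then comparable to the one of intermediate order, and the weights cancel.

Parts 2 and 3 are Hölder's inequality in `t` and in `y`: the powers of `t` and the densities of the
measures are also log-linear in the parameters. -/

/-- The entire function `∑ m, w ^ m / (m! Γ(m + a + 1))`, so that
`I_a(2 √w) = w ^ (a / 2) * besselSeries a w` for the modified Bessel function `I_a`. -/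
noncomputable def besselSeries (a w : ℝ) : ℝ :=
  ∑' m : ℕ, w ^ m / (m ! * Real.Gamma (m + a + 1))

/-! ### Gamma quotients, Kummer's transformation and binomial series. -/

lemma Gamma_natCast_add_pos {a : ℝ} (ha : -1 < a) (m : ℕ) : 0 < Real.Gamma (m + a + 1) :=
  Real.Gamma_pos_of_pos (by have := m.cast_nonneg (α := ℝ); linarith)

lemma choose_add_natCast {b : ℝ} (hb : -1 < b) (n : ℕ) :
    Ring.choose (b + n) n = Real.Gamma (b + n + 1) / (Real.Gamma (b + 1) * n !) := by
  have key : ∀ n : ℕ, (ascPochhammer ℝ n).eval (b + 1) * Real.Gamma (b + 1)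
      = Real.Gamma (b + n + 1) := by
    intro n
    induction n with
    | zero => simp
    | succ n ih =>
      have h0 : b + n + 1 ≠ 0 := by have := n.cast_nonneg (α := ℝ); linarith
      rw [ascPochhammer_succ_eval, mul_right_comm, ih, Nat.cast_add_one,
        show b + ((n : ℝ) + 1) + 1 = (b + n + 1) + 1 by ring, Real.Gamma_add_one h0]
      ring
  have h1 := Ring.factorial_nsmul_multichoose_eq_ascPochhammer (b + 1) n
  rw [Polynomial.ascPochhammer_smeval_eq_eval, Ring.multichoose_eq,
    show b + 1 + (n : ℝ) - 1 = b + n by ring, nsmul_eq_mul] at h1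
  have hG : 0 < Real.Gamma (b + 1) := Real.Gamma_pos_of_pos (by linarith)
  have hn : (0 : ℝ) < n ! := by positivity
  rw [eq_div_iff (by positivity), ← key n, ← h1]
  ring

/-- The Chu–Vandermonde identity for quotients of Gamma functions. -/
lemma Gamma_vandermonde {a : ℝ} (ha : -1 < a) (k n : ℕ) :
    Real.Gamma (a + 1 + k + n) / (Real.Gamma (a + 1 + k) * n !) =
      ∑ j ∈ Finset.range (n + 1), (k.choose j : ℝ) *
        (Real.Gamma (n + a + 1) / (Real.Gamma (j + a + 1) * ((n - j) ! : ℝ))) := by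
  have h := Ring.add_choose_eq (r := (k : ℝ)) (s := a + n) n (Commute.all _ _)
  have hk := k.cast_nonneg (α := ℝ)
  rw [show (k : ℝ) + (a + n) = (a + k) + n by ring, choose_add_natCast (by linarith)] at h
  rw [show a + 1 + k + n = a + k + n + 1 by ring, show a + 1 + k = a + k + 1 by ring, h,
    ← Finset.Nat.sum_antidiagonal_eq_sum_range_succ (fun i j => (k.choose i : ℝ) *
        (Real.Gamma (n + a + 1) / (Real.Gamma (i + a + 1) * (j ! : ℝ)))) n]
  refine Finset.sum_congr rfl fun p hp => ?_
  rw [Finset.HasAntidiagonal.mem_antidiagonal] at hp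
  have hp1 := p.1.cast_nonneg (α := ℝ)
  have e : a + (n : ℝ) = (a + p.1) + p.2 := by rw [← hp]; push_cast; ring
  rw [Ring.choose_natCast, e, choose_add_natCast (by linarith), ← e]
  ring_nf

/-- The terms with `k < m` vanish, and shifting the index by `m` leaves the exponential series. -/
lemma hasSum_choose_mul_exp (m : ℕ) (v : ℝ) :
    HasSum (fun k : ℕ => (k.choose m : ℝ) * (v ^ k / k !)) (v ^ m / m ! * Real.exp v) := by
  have hinj : Function.Injective (fun k : ℕ => k + m) := add_left_injective m
  rw [← hinj.hasSum_iff]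
  · have h := (NormedSpace.expSeries_div_hasSum_exp v).mul_left (v ^ m / m !)
    rw [← Real.exp_eq_exp_ℝ] at h
    refine h.congr_fun fun k => ?_
    have := Nat.add_choose_mul_factorial_mul_factorial k m
    have h2 : ((k + m).choose m : ℝ) * m ! * k ! = (k + m)! := by
      rw [← this, ← Nat.choose_symm_add]; push_cast; ring
    have h3 : ((k + m)! : ℝ) ≠ 0 := by positivity
    simp only [Function.comp]
    rw [← h2] at h3 ⊢
    have : ((k + m).choose m : ℝ) ≠ 0 := by intro h; simp [h] at h3
    field_simp
    ring
  · intro k hk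
    have : k < m := by
      by_contra hlt
      exact hk ⟨k - m, by simp; omega⟩
    simp [Nat.choose_eq_zero_of_lt this]

/-- Kummer's transformation of the Laguerre polynomials. -/
lemma hasSum_kummer {a : ℝ} (ha : -1 < a) (n : ℕ) (v : ℝ) :
    HasSum (fun k : ℕ => v ^ k / k ! *
        (Real.Gamma (a + 1 + k + n) / (Real.Gamma (a + 1 + k) * n !)))
      (Real.exp v * polyL a n (-v)) := by
  -- Vandermonde turns each Gamma quotient into a finite sum over `j`; for fixed `j` the sum over
  -- `k` is a shifted exponential series.
  have h : HasSum (fun k : ℕ => ∑ j ∈ Finset.range (n + 1),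
      (Real.Gamma (n + a + 1) / (Real.Gamma (j + a + 1) * ((n - j) ! : ℝ))) *
        ((k.choose j : ℝ) * (v ^ k / k !)))
      (∑ j ∈ Finset.range (n + 1),
        (Real.Gamma (n + a + 1) / (Real.Gamma (j + a + 1) * ((n - j) ! : ℝ))) *
          (v ^ j / j ! * Real.exp v)) :=
    hasSum_sum fun j _ => (hasSum_choose_mul_exp j v).mul_left _
  convert h using 1
  · ext k
    rw [Gamma_vandermonde ha, Finset.mul_sum]
    exact Finset.sum_congr rfl fun j _ => by ring
  · rw [polyL, Finset.mul_sum]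
    exact Finset.sum_congr rfl fun j _ => by rw [neg_neg]; ring

/-- Newton's binomial series for `(1 - r) ^ (-b)`, multiplied by `Γ(b)`. -/
lemma hasSum_Gamma_mul_pow {b r : ℝ} (hb : 0 < b) (hr : |r| < 1) :
    HasSum (fun n : ℕ => Real.Gamma (b + n) / n ! * r ^ n) (Real.Gamma b * (1 - r) ^ (-b)) := by
  have h := (Real.one_div_one_sub_rpow_hasFPowerSeriesOnBall_zero b).hasSum (y := r)
    (by simpa [enorm_eq_nnnorm, ← NNReal.coe_lt_coe] using hr)
  simp only [FormalMultilinearSeries.ofScalars_apply_eq, zero_add, smul_eq_mul] at h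
  have h' := h.mul_left (Real.Gamma b)
  have hr' : 0 ≤ 1 - r := by linarith [(abs_lt.1 hr).2]
  rw [Real.rpow_neg hr', ← one_div]
  refine h'.congr_fun fun n => ?_
  rw [show b + (n : ℝ) - 1 = (b - 1) + n by ring, choose_add_natCast (by linarith)]
  have : Real.Gamma b ≠ 0 := (Real.Gamma_pos_of_pos hb).ne'
  rw [show b - 1 + n + 1 = b + n by ring, show b - 1 + 1 = b by ring]
  field_simp

/-- Shifting the index by `j` gives the previous series with parameter `b + j`. -/
lemma hasSum_choose_mul_Gamma_mul_pow {b r : ℝ} (hb : 0 < b) (hr : |r| < 1) (j : ℕ) :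
    HasSum (fun n : ℕ => (n.choose j : ℝ) * r ^ n * (Real.Gamma (b + n) / n !))
      (r ^ j / j ! * Real.Gamma (b + j) * (1 - r) ^ (-(b + j))) := by
  have hinj : Function.Injective (fun k : ℕ => k + j) := add_left_injective j
  rw [← hinj.hasSum_iff]
  · have h := (hasSum_Gamma_mul_pow (b := b + j) (by positivity) hr).mul_left (r ^ j / j !)
    rw [← mul_assoc] at h
    refine h.congr_fun fun k => ?_
    have := Nat.add_choose_mul_factorial_mul_factorial k j
    have h2 : ((k + j).choose j : ℝ) * j ! * k ! = (k + j)! := by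
      rw [← this, ← Nat.choose_symm_add]; push_cast; ring
    have h3 : ((k + j)! : ℝ) ≠ 0 := by positivity
    simp only [Function.comp]
    rw [← h2] at h3 ⊢
    have : ((k + j).choose j : ℝ) ≠ 0 := by intro h; simp [h] at h3
    push_cast
    rw [show b + ((k : ℝ) + j) = b + j + k by ring]
    field_simp
    ring
  · intro k hk
    have : k < j := by
      by_contra hlt
      exact hk ⟨k - j, by simp; omega⟩
    simp [Nat.choose_eq_zero_of_lt this]

/-! ### Convergence of the Bessel series and the Laguerre generating function. -/

lemma summable_besselSeries {a : ℝ} (ha : -1 < a) (w : ℝ) :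
    Summable (fun m : ℕ => w ^ m / (m ! * Real.Gamma (m + a + 1))) := by
  have hpos := fun m => Gamma_natCast_add_pos ha m
  refine summable_of_ratio_norm_eventually_le (r := 1 / 2) (by norm_num) ?_
  -- The ratio of consecutive terms is `|w| / ((n+1)(n+a+1))`. For `n ≥ 2|w| + 1` the first factor
  -- exceeds `2|w|` and the second exceeds `1`.
  filter_upwards [Filter.eventually_ge_atTop (⌈2 * |w|⌉₊ + 1)] with n hn
  have hn' : 2 * |w| + 1 ≤ n :=
    le_trans (by gcongr; exact Nat.le_ceil _) (by exact_mod_cast hn : ((⌈2 * |w|⌉₊ : ℝ) + 1) ≤ n)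
  have hw := abs_nonneg w
  have h0 : 0 < (n : ℝ) + a + 1 := by linarith
  have hG : Real.Gamma ((n + 1 : ℕ) + a + 1) = (n + a + 1) * Real.Gamma (n + a + 1) := by
    rw [← Real.Gamma_add_one h0.ne']
    push_cast
    ring_nf
  have hGn := hpos n
  rw [hG, Nat.factorial_succ, Real.norm_eq_abs, Real.norm_eq_abs, abs_div, abs_div, abs_pow, abs_pow,
    abs_of_pos (a := (n ! : ℝ) * Real.Gamma (n + a + 1)) (by positivity),
    abs_of_pos (a := (((n + 1) * n ! : ℕ) : ℝ) * ((n + a + 1) * Real.Gamma (n + a + 1)))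
      (by positivity), pow_succ]
  have e : |w| ^ n * |w| / (((n + 1) * n ! : ℕ) * ((n + a + 1) * Real.Gamma (n + a + 1)))
      = |w| / ((n + 1) * (n + a + 1)) * (|w| ^ n / (n ! * Real.Gamma (n + a + 1))) := by
    push_cast
    field_simp
  rw [e]
  refine mul_le_mul_of_nonneg_right ?_ (by positivity)
  rw [div_le_div_iff₀ (by positivity) two_pos]
  nlinarith

/-- The generating function of the normalised Laguerre polynomials. -/
lemma hasSum_pow_mul_polyL {a : ℝ} (ha : -1 < a) (u v : ℝ) :
    HasSum (fun j : ℕ => u ^ j / Real.Gamma (j + a + 1) * polyL a j (-v))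
      (Real.exp u * besselSeries a (u * v)) := by
  -- The right-hand side is a Cauchy product; its `n`-th antidiagonal sum is the defining sum of
  -- `polyL a n (-v)`.
  have hf := summable_besselSeries ha (u * v)
  have hg := NormedSpace.expSeries_div_hasSum_exp u
  rw [← Real.exp_eq_exp_ℝ] at hg
  have hs := summable_norm_sum_mul_antidiagonal_of_summable_norm hf.norm hg.summable.norm
  have ht := tsum_mul_tsum_eq_tsum_sum_antidiagonal_of_summable_norm hf.norm hg.summable.norm
  have h := hs.of_norm.hasSum
  rw [← ht, hg.tsum_eq, mul_comm _ (Real.exp u)] at h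
  refine h.congr_fun fun n => ?_
  rw [Finset.Nat.sum_antidiagonal_eq_sum_range_succ (fun i j => (u * v) ^ i /
    (i ! * Real.Gamma (i + a + 1)) * (u ^ j / j !)) n, polyL, Finset.mul_sum]
  refine Finset.sum_congr rfl fun j hj => ?_
  have hj' : j ≤ n := by simpa [Nat.lt_succ_iff] using hj
  have h1 := (Gamma_natCast_add_pos ha n).ne'
  have h2 := (Gamma_natCast_add_pos ha j).ne'
  rw [neg_neg, mul_pow, ← Nat.add_sub_cancel' hj', pow_add]
  simp only [Nat.add_sub_cancel' hj']
  field_simp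

/-! ### Rearranged triple series and the Hille–Hardy formula. -/

lemma hasSum_of_hasSum_of_eq {f : ℕ → ℝ} {s t : ℝ} (h : HasSum f s) (e : t = s) : HasSum f t :=
  e ▸ h

/-- Tonelli: for nonnegative terms, convergence of the iterated sums in one order gives joint
summability. -/
lemma summable_of_nonneg_of_hasSum_hasSum_hasSum {f : ℕ → ℕ → ℕ → ℝ} {g : ℕ → ℕ → ℝ} {h : ℕ → ℝ}
    {s : ℝ} (hf : ∀ j k n, 0 ≤ f j k n) (h₁ : ∀ j k, HasSum (f j k) (g j k))
    (h₂ : ∀ j, HasSum (g j) (h j)) (h₃ : HasSum h s) :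
    Summable (fun p : ℕ × ℕ × ℕ => f p.1 p.2.1 p.2.2) := by
  rw [summable_prod_of_nonneg fun p => hf _ _ _]
  have key : ∀ j, HasSum (fun q : ℕ × ℕ => f j q.1 q.2) (h j) := by
    intro j
    have hs : Summable (fun q : ℕ × ℕ => f j q.1 q.2) := by
      rw [summable_prod_of_nonneg fun q => hf _ _ _]
      exact ⟨fun k => (h₁ j k).summable, by simpa only [(h₁ j _).tsum_eq] using (h₂ j).summable⟩
    have := hs.hasSum.prod_fiberwise (h₁ j)
    rw [← this.unique (h₂ j)]
    exact hs.hasSum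
  exact ⟨fun j => (key j).summable, by simpa only [(key _).tsum_eq] using h₃.summable⟩

/-- Fubini: the order `n`, `k`, `j` (innermost first) is traded for `k`, `j`, `n`. -/
lemma hasSum_of_hasSum_rotate {f : ℕ → ℕ → ℕ → ℝ} {g g' : ℕ → ℕ → ℝ} {h h' : ℕ → ℝ} {s : ℝ}
    (hf : Summable (fun p : ℕ × ℕ × ℕ => f p.1 p.2.1 p.2.2)) (h₁ : ∀ j k, HasSum (f j k) (g j k))
    (h₂ : ∀ j, HasSum (g j) (h j)) (h₃ : HasSum h s)
    (h₁' : ∀ n j, HasSum (fun k => f j k n) (g' n j)) (h₂' : ∀ n, HasSum (g' n) (h' n)) :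
    HasSum h' s := by
  have hS : HasSum (fun p : ℕ × ℕ × ℕ => f p.1 p.2.1 p.2.2) s := by
    have e1 : ∀ j, HasSum (fun q : ℕ × ℕ => f j q.1 q.2) (h j) := by
      intro j
      have hs : Summable (fun q : ℕ × ℕ => f j q.1 q.2) :=
        hf.comp_injective (Prod.mk_right_injective j)
      have := hs.hasSum.prod_fiberwise (h₁ j)
      rw [← this.unique (h₂ j)]
      exact hs.hasSum
    rw [← (hf.hasSum.prod_fiberwise e1).unique h₃]
    exact hf.hasSum
  let e : (ℕ × ℕ) × ℕ ≃ ℕ × ℕ × ℕ :=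
    { toFun := fun p => (p.1.2, p.2, p.1.1)
      invFun := fun p => ((p.2.2, p.1), p.2.1)
      left_inv := fun _ => rfl
      right_inv := fun _ => rfl }
  have hS' : HasSum (fun p : ℕ × ℕ => g' p.1 p.2) s :=
    HasSum.prod_fiberwise (f := fun p : (ℕ × ℕ) × ℕ => f p.1.2 p.2 p.1.1) (e.hasSum_iff.2 hS)
      fun p => h₁' p.1 p.2
  exact hS'.prod_fiberwise h₂'

/-- The summand of the triple expansion of the bilinear generating function. -/
noncomputable def hilleHardyTerm (a r x y : ℝ) (j k n : ℕ) : ℝ :=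
  (-y) ^ j / Real.Gamma (j + a + 1) * ((-x) ^ k / (k ! * Real.Gamma (a + 1 + k)) *
    ((n.choose j : ℝ) * r ^ n * (Real.Gamma (a + 1 + k + n) / n !)))

/-- All signs come from the powers of `-x` and `-y`, so the absolute series is the same series at
other arguments and its iterated sums are known too. -/
lemma abs_hilleHardyTerm {a r : ℝ} (ha : -1 < a) (hr : 0 ≤ r) (x y : ℝ) (j k n : ℕ) :
    |hilleHardyTerm a r x y j k n| = hilleHardyTerm a r (-|x|) (-|y|) j k n := by
  have hk := k.cast_nonneg (α := ℝ)
  have h1 := Gamma_natCast_add_pos ha j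
  have h2 : 0 < Real.Gamma (a + 1 + k) := Real.Gamma_pos_of_pos (by linarith)
  have h3 : 0 < Real.Gamma (a + 1 + k + n) :=
    Real.Gamma_pos_of_pos (by have := n.cast_nonneg (α := ℝ); linarith)
  simp only [hilleHardyTerm, abs_mul, abs_div, abs_pow, abs_neg, neg_neg, Nat.abs_cast,
    abs_of_pos h1, abs_of_pos h2, abs_of_pos h3, abs_of_nonneg hr]

/-- The **Hille–Hardy formula**. -/
theorem hasSum_hilleHardy {a r : ℝ} (ha : -1 < a) (hr₀ : 0 ≤ r) (hr₁ : r < 1) (x y : ℝ) :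
    HasSum (fun n : ℕ => r ^ n * (n ! / Real.Gamma (n + a + 1)) * (polyL a n x * polyL a n y))
      ((1 - r) ^ (-(a + 1)) * Real.exp (-(x + y) * r / (1 - r)) *
        besselSeries a (x * y * r / (1 - r) ^ 2)) := by
  have hr : |r| < 1 := by rwa [abs_of_nonneg hr₀]
  have h1r : 0 < 1 - r := by linarith
  have Gp : ∀ k : ℕ, 0 < Real.Gamma (a + 1 + k) := fun k =>
    Real.Gamma_pos_of_pos (by have := k.cast_nonneg (α := ℝ); linarith)
  -- `H1`–`H3` sum over `n` (binomial series), `k` (Kummer) and `j` (generating function). They are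
  -- stated for all arguments because they are used both at `(x, y)` and, for absolute convergence,
  -- at `(-|x|, -|y|)`.
  have H1 : ∀ x y : ℝ, ∀ j k : ℕ, HasSum (hilleHardyTerm a r x y j k)
      ((1 - r) ^ (-(a + 1)) * ((-y * r / (1 - r)) ^ j / Real.Gamma (j + a + 1)) *
        ((-x / (1 - r)) ^ k / k ! *
          (Real.Gamma (a + 1 + k + j) / (Real.Gamma (a + 1 + k) * j !)))) := by
    intro x y j k
    have h := ((hasSum_choose_mul_Gamma_mul_pow (b := a + 1 + k) (r := r)
      (by have := k.cast_nonneg (α := ℝ); linarith) hr j).mul_left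
      ((-x) ^ k / (k ! * Real.Gamma (a + 1 + k)))).mul_left ((-y) ^ j / Real.Gamma (j + a + 1))
    have e : (1 - r) ^ (-(a + 1 + k + j)) =
        (1 - r) ^ (-(a + 1)) * ((1 - r) ^ k)⁻¹ * ((1 - r) ^ j)⁻¹ := by
      rw [show -(a + 1 + k + j) = -(a + 1) + -(k : ℝ) + -(j : ℝ) by ring, Real.rpow_add h1r,
        Real.rpow_add h1r, Real.rpow_neg h1r.le, Real.rpow_neg h1r.le k, Real.rpow_neg h1r.le j,
        Real.rpow_natCast, Real.rpow_natCast]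
    refine hasSum_of_hasSum_of_eq h ?_
    rw [e, div_pow, div_pow, mul_pow]
    have := (Gp k).ne'
    have := (Gamma_natCast_add_pos ha j).ne'
    field_simp
  have H2 : ∀ x y : ℝ, ∀ j : ℕ, HasSum (fun k =>
      (1 - r) ^ (-(a + 1)) * ((-y * r / (1 - r)) ^ j / Real.Gamma (j + a + 1)) *
        ((-x / (1 - r)) ^ k / k ! *
          (Real.Gamma (a + 1 + k + j) / (Real.Gamma (a + 1 + k) * j !))))
      ((1 - r) ^ (-(a + 1)) * Real.exp (-x / (1 - r)) *
        ((-y * r / (1 - r)) ^ j / Real.Gamma (j + a + 1) * polyL a j (-(-x / (1 - r))))) := by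
    intro x y j
    refine hasSum_of_hasSum_of_eq ((hasSum_kummer ha j (-x / (1 - r))).mul_left
      ((1 - r) ^ (-(a + 1)) * ((-y * r / (1 - r)) ^ j / Real.Gamma (j + a + 1)))) ?_
    ring
  have H3 : ∀ x y : ℝ, HasSum (fun j : ℕ => (1 - r) ^ (-(a + 1)) * Real.exp (-x / (1 - r)) *
        ((-y * r / (1 - r)) ^ j / Real.Gamma (j + a + 1) * polyL a j (-(-x / (1 - r)))))
      ((1 - r) ^ (-(a + 1)) * Real.exp (-x / (1 - r)) *
        (Real.exp (-y * r / (1 - r)) * besselSeries a (-y * r / (1 - r) * (-x / (1 - r))))) :=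
    fun x y => (hasSum_pow_mul_polyL ha _ _).mul_left _
  have hsum : Summable (fun p : ℕ × ℕ × ℕ => hilleHardyTerm a r x y p.1 p.2.1 p.2.2) := by
    refine Summable.of_abs ?_
    simp only [abs_hilleHardyTerm ha hr₀]
    refine summable_of_nonneg_of_hasSum_hasSum_hasSum (fun j k n => ?_) (H1 _ _) (H2 _ _) (H3 _ _)
    rw [← abs_hilleHardyTerm ha hr₀]
    exact abs_nonneg _
  -- In the other order, the sum over `k` produces `polyL a n x` by Kummer, and the sum over `j`,
  -- finite since `n.choose j = 0` for `j > n`, produces `polyL a n y`.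
  have H1' : ∀ n j : ℕ, HasSum (fun k => hilleHardyTerm a r x y j k n)
      ((-y) ^ j / Real.Gamma (j + a + 1) * ((n.choose j : ℝ) * r ^ n) *
        (Real.exp (-x) * polyL a n x)) := by
    intro n j
    have h := (hasSum_kummer ha n (-x)).mul_left
      ((-y) ^ j / Real.Gamma (j + a + 1) * ((n.choose j : ℝ) * r ^ n))
    rw [neg_neg] at h
    refine h.congr_fun fun k => ?_
    rw [hilleHardyTerm]
    have := (Gp k).ne'
    field_simp
  have H2' : ∀ n : ℕ, HasSum (fun j : ℕ =>
      (-y) ^ j / Real.Gamma (j + a + 1) * ((n.choose j : ℝ) * r ^ n) *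
        (Real.exp (-x) * polyL a n x))
      (Real.exp (-x) * (r ^ n * (n ! / Real.Gamma (n + a + 1)) * (polyL a n x * polyL a n y))) := by
    intro n
    refine hasSum_of_hasSum_of_eq (hasSum_sum_of_ne_finset_zero (s := Finset.range (n + 1))
      fun j hj => ?_) ?_
    · rw [Nat.choose_eq_zero_of_lt (by simpa [Nat.lt_succ_iff] using hj)]
      simp
    · rw [← Finset.sum_mul, polyL.eq_1 a n y]
      simp only [Finset.mul_sum, Finset.sum_mul]
      refine Finset.sum_congr rfl fun j hj => ?_
      have hj' : j ≤ n := by simpa [Nat.lt_succ_iff] using hj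
      rw [Nat.cast_choose ℝ hj']
      have := (Gamma_natCast_add_pos ha n).ne'
      have := (Gamma_natCast_add_pos ha j).ne'
      field_simp
  have := hasSum_of_hasSum_rotate hsum (H1 x y) (H2 x y) (H3 x y) H1' H2'
  have := this.mul_left (Real.exp x)
  simp only [← mul_assoc (Real.exp x) (Real.exp (-x)), ← Real.exp_add, add_neg_cancel,
    Real.exp_zero, one_mul] at this
  refine hasSum_of_hasSum_of_eq this ?_
  rw [show -y * r / (1 - r) * (-x / (1 - r)) = x * y * r / (1 - r) ^ 2 by field_simp,
    show -(x + y) * r / (1 - r) = x + (-x / (1 - r) + (-y * r / (1 - r))) by field_simp; ring,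
    Real.exp_add x, Real.exp_add]
  ring

/-! ### Closed form and positivity of the heat kernel. -/

lemma besselSeries_term_nonneg {a w : ℝ} (ha : -1 < a) (hw : 0 ≤ w) (m : ℕ) :
    0 ≤ w ^ m / (m ! * Real.Gamma (m + a + 1)) := by
  have := Gamma_natCast_add_pos ha m
  positivity

lemma besselSeries_pos {a w : ℝ} (ha : -1 < a) (hw : 0 ≤ w) : 0 < besselSeries a w := by
  refine (summable_besselSeries ha w).tsum_pos (besselSeries_term_nonneg ha hw) 0 ?_
  have := Gamma_natCast_add_pos ha 0
  positivity

/-- The one-dimensional Laguerre heat kernel in closed form. -/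
noncomputable def heatFactor (a t x y : ℝ) : ℝ :=
  (Real.exp (-2 * t) / (1 - Real.exp (-4 * t))) ^ (a + 1) *
    (2 * Real.exp (-(x ^ 2 + y ^ 2) / 2) *
      Real.exp (-(x ^ 2 + y ^ 2) * Real.exp (-4 * t) / (1 - Real.exp (-4 * t)))) *
    besselSeries a (x ^ 2 * y ^ 2 * Real.exp (-4 * t) / (1 - Real.exp (-4 * t)) ^ 2)

lemma one_sub_exp_pos {t : ℝ} (ht : 0 < t) : 0 < 1 - Real.exp (-4 * t) := by
  have : Real.exp (-4 * t) < 1 := Real.exp_lt_one_iff.2 (by linarith)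
  linarith

lemma heatFactor_pos {a t : ℝ} (ha : -1 < a) (ht : 0 < t) (x y : ℝ) : 0 < heatFactor a t x y := by
  have h1 := one_sub_exp_pos ht
  have h2 : 0 < besselSeries a
      (x ^ 2 * y ^ 2 * Real.exp (-4 * t) / (1 - Real.exp (-4 * t)) ^ 2) :=
    besselSeries_pos ha (by positivity)
  unfold heatFactor
  positivity

lemma hasSum_ell1 {a t : ℝ} (ha : -1 < a) (ht : 0 < t) (x y : ℝ) :
    HasSum (fun n : ℕ => Real.exp (-4 * t) ^ n * (ell1 a n x * ell1 a n y))
      ((2 * Real.exp (-(x ^ 2 + y ^ 2) / 2)) *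
        ((1 - Real.exp (-4 * t)) ^ (-(a + 1)) *
          Real.exp (-(x ^ 2 + y ^ 2) * Real.exp (-4 * t) / (1 - Real.exp (-4 * t))) *
          besselSeries a (x ^ 2 * y ^ 2 * Real.exp (-4 * t) / (1 - Real.exp (-4 * t)) ^ 2))) := by
  have h := (hasSum_hilleHardy ha (Real.exp_nonneg (-4 * t))
    (by linarith [one_sub_exp_pos ht]) (x ^ 2) (y ^ 2)).mul_left
      (2 * Real.exp (-(x ^ 2 + y ^ 2) / 2))
  refine h.congr_fun fun n => ?_
  have hG := Gamma_natCast_add_pos ha n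
  have hs : Real.sqrt (2 * Real.Gamma (n + 1) / Real.Gamma (n + a + 1)) *
      Real.sqrt (2 * Real.Gamma (n + 1) / Real.Gamma (n + a + 1)) =
      2 * (n ! / Real.Gamma (n + a + 1)) := by
    rw [Real.Gamma_nat_eq_factorial, Real.mul_self_sqrt (by positivity), mul_div_assoc]
  have he : Real.exp (-(x ^ 2 + y ^ 2) / 2) = Real.exp (-x ^ 2 / 2) * Real.exp (-y ^ 2 / 2) := by
    rw [← Real.exp_add]; ring_nf
  rw [he]
  unfold ell1
  linear_combination (Real.exp (-4 * t) ^ n * polyL a n (x ^ 2) * Real.exp (-x ^ 2 / 2) *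
    (polyL a n (y ^ 2) * Real.exp (-y ^ 2 / 2))) * hs

/-- An iterated Cauchy product, by induction on `s`; in `ℝ` summability already gives the absolute
convergence it needs. -/
lemma hasSum_sum_piAntidiag_prod {ι : Type*} [DecidableEq ι] (s : Finset ι) (f : ι → ℕ → ℝ)
    (hf : ∀ i ∈ s, Summable (f i)) :
    HasSum (fun n => ∑ k ∈ Finset.piAntidiag s n, ∏ i ∈ s, f i (k i)) (∏ i ∈ s, ∑' n, f i n) := by
  induction s using Finset.cons_induction with
  | empty =>
    rw [Finset.prod_empty]
    refine hasSum_of_hasSum_of_eq (hasSum_single 0 fun n hn => ?_) ?_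
    · rw [Finset.piAntidiag_empty_of_ne_zero hn, Finset.sum_empty]
    · simp
  | cons i s hi ih =>
    have ih' := ih fun j hj => hf j (Finset.mem_cons_of_mem hj)
    have hi' := hf i (Finset.mem_cons_self i s)
    have hs := summable_norm_sum_mul_antidiagonal_of_summable_norm hi'.norm ih'.summable.norm
    have ht := tsum_mul_tsum_eq_tsum_sum_antidiagonal_of_summable_norm hi'.norm ih'.summable.norm
    have h := hs.of_norm.hasSum
    rw [← ht, ih'.tsum_eq] at h
    rw [Finset.prod_cons]
    refine h.congr_fun fun n => ?_
    rw [Finset.piAntidiag_cons hi, Finset.sum_disjiUnion]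
    refine Finset.sum_congr rfl fun p _ => ?_
    rw [Finset.sum_map, Finset.mul_sum]
    refine Finset.sum_congr rfl fun k hk => ?_
    -- Multi-indices over `s` vanish off `s`, so adding `p.1` in position `i` gives exactly the
    -- value `p.1` there.
    have hki : k i = 0 := by
      by_contra h0
      exact hi ((Finset.mem_piAntidiag.1 hk).2 i h0)
    rw [Finset.prod_cons]
    congr 1
    · simp [hki]
    · refine Finset.prod_congr rfl fun j hj => ?_
      have : j ≠ i := fun e => hi (e ▸ hj)
      simp [this]

theorem hasSum_heatTerm {d : ℕ} {δ : Fin d → ℝ} (hδ : ∀ i, -1 < δ i) {t : ℝ} (ht : 0 < t)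
    (x y : Fin d → ℝ) :
    HasSum (heatTerm δ t x y) (∏ i, heatFactor (δ i) t (x i) (y i)) := by
  have h := (hasSum_sum_piAntidiag_prod Finset.univ
    (fun i n => Real.exp (-4 * t) ^ n * (ell1 (δ i) n (x i) * ell1 (δ i) n (y i)))
    fun i _ => (hasSum_ell1 (hδ i) ht _ _).summable).mul_left (∏ i, Real.exp (-2 * t) ^ (δ i + 1))
  rw [← Finset.prod_mul_distrib] at h
  have e : ∀ i, heatFactor (δ i) t (x i) (y i) = Real.exp (-2 * t) ^ (δ i + 1) *
      ∑' n, Real.exp (-4 * t) ^ n * (ell1 (δ i) n (x i) * ell1 (δ i) n (y i)) := by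
    intro i
    have h1 := one_sub_exp_pos ht
    rw [(hasSum_ell1 (hδ i) ht _ _).tsum_eq, heatFactor, Real.div_rpow (Real.exp_nonneg _) h1.le,
      Real.rpow_neg h1.le]
    ring
  simp only [e]
  refine h.congr_fun fun n => ?_
  -- The spectral exponent splits into one factor per coordinate, which `heatFactor` absorbs into
  -- its power of order `δ i + 1`, and the generating variable `exp (-4t)` to the power `n`.
  have e1 : Real.exp (-t * (4 * n + 2 * (∑ i, δ i) + 2 * d)) =
      (∏ i, Real.exp (-2 * t) ^ (δ i + 1)) * Real.exp (-4 * t) ^ n := by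
    simp only [← Real.exp_mul, ← Real.exp_sum, ← Real.exp_nat_mul, ← Real.exp_add,
      ← Finset.mul_sum, Finset.sum_add_distrib]
    congr 1
    simp
    ring
  rw [heatTerm, e1, mul_assoc, Finset.mul_sum]
  congr 1
  refine Finset.sum_congr rfl fun k hk => ?_
  have hk' := (Finset.mem_piAntidiag.1 hk).1
  rw [Finset.prod_mul_distrib, Finset.prod_pow_eq_pow_sum, hk', Finset.prod_mul_distrib]
  rfl

lemma heatKernel_eq {d : ℕ} {δ : Fin d → ℝ} (hδ : ∀ i, -1 < δ i) {t : ℝ} (ht : 0 < t)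
    (x y : Fin d → ℝ) : heatKernel δ t x y = ∏ i, heatFactor (δ i) t (x i) (y i) :=
  (hasSum_heatTerm hδ ht x y).tsum_eq

lemma heatKernel_pos {d : ℕ} {δ : Fin d → ℝ} (hδ : ∀ i, -1 < δ i) {t : ℝ} (ht : 0 < t)
    (x y : Fin d → ℝ) : 0 < heatKernel δ t x y := by
  rw [heatKernel_eq hδ ht]
  exact Finset.prod_pos fun i _ => heatFactor_pos (hδ i) ht _ _

/-! ### Inequalities between Bessel series of different orders. -/

/-- Hölder's inequality for `besselSeries`, reduced to an inequality between Gamma values. -/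
lemma besselSeries_le_rpow_mul_rpow {p q s θ K : ℝ} (hp : -1 < p) (hq : -1 < q) (hs : -1 < s)
    (hθ₀ : 0 ≤ θ) (hθ₁ : θ ≤ 1) (hK : 0 ≤ K)
    (h : ∀ m : ℕ, Real.Gamma (m + p + 1) ^ (1 - θ) * Real.Gamma (m + q + 1) ^ θ ≤
      K * Real.Gamma (m + s + 1)) {w : ℝ} (hw : 0 ≤ w) :
    besselSeries s w ≤ K * (besselSeries p w ^ (1 - θ) * besselSeries q w ^ θ) := by
  set A := besselSeries p w with hA
  set B := besselSeries q w with hB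
  have hAp : 0 < A := besselSeries_pos hp hw
  have hBp : 0 < B := besselSeries_pos hq hw
  have hsA : HasSum (fun m : ℕ => w ^ m / (m ! * Real.Gamma (m + p + 1))) A :=
    (summable_besselSeries hp w).hasSum
  have hsB : HasSum (fun m : ℕ => w ^ m / (m ! * Real.Gamma (m + q + 1))) B :=
    (summable_besselSeries hq w).hasSum
  -- Hölder through Young: once the two series are normalised to sum `1`, the weighted arithmetic
  -- means of their terms sum to `(1 - θ) + θ = 1`.
  have hR := (((hsA.div_const A).mul_left (1 - θ)).add ((hsB.div_const B).mul_left θ)).mul_left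
    (K * (A ^ (1 - θ) * B ^ θ))
  have e : K * (A ^ (1 - θ) * B ^ θ) * ((1 - θ) * (A / A) + θ * (B / B)) =
      K * (A ^ (1 - θ) * B ^ θ) := by
    rw [div_self hAp.ne', div_self hBp.ne']; ring
  rw [e] at hR
  refine hasSum_le (fun m => ?_) (summable_besselSeries hs w).hasSum hR
  have hGp := Gamma_natCast_add_pos hp m
  have hGq := Gamma_natCast_add_pos hq m
  have hGs := Gamma_natCast_add_pos hs m
  have hx : 0 ≤ w ^ m / (m ! : ℝ) := by positivity
  have hx1 : (w ^ m / (m ! : ℝ)) ^ (1 - θ) * (w ^ m / (m ! : ℝ)) ^ θ = w ^ m / (m ! : ℝ) := by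
    rw [← Real.rpow_add' hx (by simp), sub_add_cancel, Real.rpow_one]
  have hgm := Real.geom_mean_le_arith_mean2_weighted (sub_nonneg.2 hθ₁) hθ₀
    (div_nonneg (besselSeries_term_nonneg hp hw m) hAp.le)
    (div_nonneg (besselSeries_term_nonneg hq hw m) hBp.le) (sub_add_cancel 1 θ)
  calc w ^ m / (m ! * Real.Gamma (m + s + 1))
      ≤ K * ((w ^ m / (m ! * Real.Gamma (m + p + 1))) ^ (1 - θ) *
          (w ^ m / (m ! * Real.Gamma (m + q + 1))) ^ θ) := by
        rw [← div_div, ← div_div, ← div_div, Real.div_rpow hx hGp.le, Real.div_rpow hx hGq.le,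
          div_mul_div_comm, hx1, ← mul_div_assoc, div_le_div_iff₀ hGs (by positivity)]
        nlinarith [mul_le_mul_of_nonneg_left (h m) hx]
    _ = K * (A ^ (1 - θ) * B ^ θ) * ((w ^ m / (m ! * Real.Gamma (m + p + 1)) / A) ^ (1 - θ) *
          (w ^ m / (m ! * Real.Gamma (m + q + 1)) / B) ^ θ) := by
        rw [Real.div_rpow (besselSeries_term_nonneg hp hw m) hAp.le,
          Real.div_rpow (besselSeries_term_nonneg hq hw m) hBp.le]
        have := Real.rpow_pos_of_pos hAp (1 - θ)
        have := Real.rpow_pos_of_pos hBp θ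
        field_simp
    _ ≤ _ := mul_le_mul_of_nonneg_left hgm (by positivity)

/-- A Gautschi-type inequality. -/
lemma Gamma_rpow_mul_Gamma_add_one_rpow_le {b s : ℝ} (hb : 0 < b) (hs₀ : 0 < s) (hs₁ : s < 1) :
    Real.Gamma b ^ (1 - s) * Real.Gamma (b + 1) ^ s ≤ (1 + 1 / b) * Real.Gamma (b + s) := by
  have hG : 0 < Real.Gamma b := Real.Gamma_pos_of_pos hb
  have hGs : 0 < Real.Gamma (b + s) := Real.Gamma_pos_of_pos (by linarith)
  -- Log-convexity alone goes the wrong way. Applied at `b + 1` between `b + s` and `b + s + 1`, it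
  -- gives `Γ(b+1) ≤ (b+s)^(1-s) Γ(b+s)`, which reverses it at the cost of a factor `1 + 1/b`.
  have h := Real.Gamma_mul_add_mul_le_rpow_Gamma_mul_rpow_Gamma (s := b + s) (t := b + s + 1)
    (a := s) (b := 1 - s) (by linarith) (by linarith) hs₀ (by linarith) (by ring)
  rw [show s * (b + s) + (1 - s) * (b + s + 1) = b + 1 by ring, Real.Gamma_add_one hb.ne',
    Real.Gamma_add_one (by linarith : b + s ≠ 0), Real.mul_rpow (by linarith) hGs.le, mul_left_comm,
    ← Real.rpow_add hGs, add_sub_cancel, Real.rpow_one] at h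
  have e : Real.Gamma b ^ (1 - s) * Real.Gamma (b + 1) ^ s = b * Real.Gamma b / b ^ (1 - s) := by
    rw [Real.Gamma_add_one hb.ne', Real.mul_rpow hb.le hG.le, mul_left_comm, ← Real.rpow_add hG,
      sub_add_cancel, Real.rpow_one, Real.rpow_sub hb, Real.rpow_one]
    have := Real.rpow_pos_of_pos hb s
    field_simp
  have h1 : ((b + s) / b) ^ (1 - s) ≤ 1 + 1 / b := by
    calc ((b + s) / b) ^ (1 - s) ≤ ((b + s) / b) ^ (1 : ℝ) :=
          Real.rpow_le_rpow_of_exponent_le (by rw [le_div_iff₀ hb]; linarith) (by linarith)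
      _ = 1 + s / b := by rw [Real.rpow_one]; field_simp
      _ ≤ _ := by gcongr
  rw [e]
  calc b * Real.Gamma b / b ^ (1 - s) ≤ (b + s) ^ (1 - s) * Real.Gamma (b + s) / b ^ (1 - s) := by
        gcongr
    _ = ((b + s) / b) ^ (1 - s) * Real.Gamma (b + s) := by
        rw [Real.div_rpow (by linarith) hb.le]; ring
    _ ≤ _ := by gcongr

/-- Coefficientwise this is `Γ(m+a+2) = (m + (a+1)) Γ(m+a+1)`; the part with factor `m` loses its
zeroth term and shifts to order `a + 2`. -/
lemma besselSeries_recurrence {a : ℝ} (ha : -1 < a) (w : ℝ) :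
    besselSeries a w = (a + 1) * besselSeries (a + 1) w + w * besselSeries (a + 2) w := by
  have h1 := ((summable_besselSeries (a := a + 1) (by linarith) w).hasSum).mul_left (a + 1)
  have h2 : HasSum (fun m : ℕ => m * (w ^ m / (m ! * Real.Gamma (m + (a + 1) + 1))))
      (w * besselSeries (a + 2) w) := by
    rw [← hasSum_nat_add_iff' 1]
    have := ((summable_besselSeries (a := a + 2) (by linarith) w).hasSum).mul_left w
    simp only [Finset.range_one, Finset.sum_singleton, Nat.cast_zero, zero_mul, sub_zero]
    refine this.congr_fun fun m => ?_
    have hG := (Gamma_natCast_add_pos (a := a + 2) (by linarith) m).ne'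
    rw [show ((m + 1 : ℕ) : ℝ) + (a + 1) + 1 = m + (a + 2) + 1 by push_cast; ring,
      Nat.factorial_succ]
    push_cast
    field_simp
    ring
  refine (((h1.add h2).congr_fun fun m => ?_).unique (summable_besselSeries ha w).hasSum).symm
  have h0 : 0 < (m : ℝ) + a + 1 := by have := m.cast_nonneg (α := ℝ); linarith
  have hG := (Gamma_natCast_add_pos ha m).ne'
  rw [show (m : ℝ) + (a + 1) + 1 = (m + a + 1) + 1 by ring, Real.Gamma_add_one h0.ne']
  field_simp
  ring

/-- Hölder with `θ = 1/2` bounds order `a + 1` by the geometric mean of orders `a` and `a + 2`, and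
the recurrence gives `w * besselSeries (a + 2) w ≤ besselSeries a w`. -/
lemma sqrt_mul_besselSeries_add_one_le {a w : ℝ} (ha : -1 < a) (hw : 0 ≤ w) :
    √w * besselSeries (a + 1) w ≤ (1 + 1 / (a + 1)) * besselSeries a w := by
  have ha' : 0 < a + 1 := by linarith
  have hF0 := besselSeries_pos ha hw
  have hF1 := besselSeries_pos (a := a + 1) (by linarith) hw
  have hF2 := besselSeries_pos (a := a + 2) (by linarith) hw
  have hle : w * besselSeries (a + 2) w ≤ besselSeries a w := by
    rw [besselSeries_recurrence ha]
    nlinarith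
  have h := besselSeries_le_rpow_mul_rpow (p := a) (q := a + 2) (s := a + 1) (θ := 1 / 2)
    (K := 1 + 1 / (a + 1)) ha (by linarith) (by linarith) (by norm_num) (by norm_num)
    (by positivity) (fun m => ?_) hw
  · rw [show (1 : ℝ) - 1 / 2 = 1 / 2 by norm_num, ← Real.sqrt_eq_rpow, ← Real.sqrt_eq_rpow] at h
    calc √w * besselSeries (a + 1) w
        ≤ √w * ((1 + 1 / (a + 1)) * (√(besselSeries a w) * √(besselSeries (a + 2) w))) := by gcongr
      _ = (1 + 1 / (a + 1)) * (√(besselSeries a w) * √(w * besselSeries (a + 2) w)) := by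
        rw [Real.sqrt_mul hw]; ring
      _ ≤ (1 + 1 / (a + 1)) * (√(besselSeries a w) * √(besselSeries a w)) := by gcongr
      _ = _ := by rw [Real.mul_self_sqrt hF0.le]
  · have hm := m.cast_nonneg (α := ℝ)
    set b : ℝ := m + a + 1 with hb
    have hb0 : 0 < b := by linarith
    have hG : 0 < Real.Gamma b := Real.Gamma_pos_of_pos hb0
    rw [show (m : ℝ) + (a + 2) + 1 = b + 1 + 1 by rw [hb]; ring,
      show (m : ℝ) + (a + 1) + 1 = b + 1 by rw [hb]; ring,
      Real.Gamma_add_one (by linarith : b + 1 ≠ 0), Real.Gamma_add_one hb0.ne',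
      show (1 : ℝ) - 1 / 2 = 1 / 2 by norm_num, ← Real.sqrt_eq_rpow, ← Real.sqrt_eq_rpow,
      ← Real.sqrt_mul hG.le]
    refine Real.sqrt_le_iff.2 ⟨by positivity, ?_⟩
    -- The constant is uniform in `m` because `b ≥ a + 1`.
    have h1 : b + 1 ≤ (1 + 1 / (a + 1)) * b := by
      have : 1 ≤ 1 / (a + 1) * b := by rw [one_div_mul_eq_div, le_div_iff₀ ha']; linarith
      linarith
    have h2 : (1 + 1 / (a + 1)) * b ≤ (1 + 1 / (a + 1)) ^ 2 * b := by
      have : 0 < 1 / (a + 1) := by positivity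
      nlinarith [mul_pos this hb0]
    calc Real.Gamma b * ((b + 1) * (b * Real.Gamma b))
        = (b + 1) * (b * Real.Gamma b ^ 2) := by ring
      _ ≤ (1 + 1 / (a + 1)) ^ 2 * b * (b * Real.Gamma b ^ 2) := by gcongr; exact h1.trans h2
      _ = _ := by ring

/-! ### Comparability of the weighted Bessel series of all orders. -/

/-- `besselSeries` with its polynomial decay relative to `exp (2 √w)` compensated. -/
noncomputable def weightedBessel (a w : ℝ) : ℝ := besselSeries a w * (1 + √w) ^ a

lemma weightedBessel_pos {a w : ℝ} (ha : -1 < a) (hw : 0 ≤ w) : 0 < weightedBessel a w :=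
  mul_pos (besselSeries_pos ha hw) (by positivity)

lemma weightedBessel_nonneg_eventually {a : ℝ} (ha : -1 < a) :
    0 ≤ᶠ[𝓟 (Ici 0)] weightedBessel a :=
  eventually_principal.2 fun _ hw => (weightedBessel_pos ha hw).le

/-- Over the principal filter `𝓟 (Ici 0)`, `=O` means one constant for all `w ≥ 0`; no limit is
involved. -/
lemma weightedBessel_isBigO_of_le {a b C : ℝ} (ha : -1 < a)
    (h : ∀ w, 0 ≤ w → weightedBessel a w ≤ C * weightedBessel b w) (hb : -1 < b) :
    weightedBessel a =O[𝓟 (Ici 0)] weightedBessel b := by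
  refine isBigO_principal.2 ⟨C, fun w hw => ?_⟩
  rw [Real.norm_of_nonneg (weightedBessel_pos ha hw).le,
    Real.norm_of_nonneg (weightedBessel_pos hb hw).le]
  exact h w hw

lemma weightedBessel_add_one_isTheta {a : ℝ} (ha : -1 < a) :
    weightedBessel (a + 1) =Θ[𝓟 (Ici 0)] weightedBessel a := by
  have key : ∀ a : ℝ, -1 < a → ∀ w, 0 ≤ w →
      besselSeries (a + 1) w * (1 + √w) ≤ (1 + 2 / (a + 1)) * besselSeries a w := by
    intro a ha w hw
    have h1 := sqrt_mul_besselSeries_add_one_le ha hw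
    have ha' : 0 < a + 1 := by linarith
    have h2 : besselSeries (a + 1) w ≤ 1 / (a + 1) * besselSeries a w := by
      rw [one_div_mul_eq_div, le_div_iff₀ ha', besselSeries_recurrence ha]
      nlinarith [mul_nonneg hw (besselSeries_pos (a := a + 2) (by linarith) hw).le]
    have : 2 / (a + 1) = 1 / (a + 1) + 1 / (a + 1) := by ring
    rw [this]
    linarith
  have hw1 : ∀ w : ℝ, 0 < 1 + √w := fun w => by positivity
  constructor
  · refine weightedBessel_isBigO_of_le (C := 1 + 2 / (a + 1)) (by linarith) (fun w hw => ?_) ha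
    rw [weightedBessel, weightedBessel, Real.rpow_add_one (hw1 w).ne']
    nlinarith [mul_le_mul_of_nonneg_right (key a ha w hw) (Real.rpow_nonneg (hw1 w).le a)]
  · refine weightedBessel_isBigO_of_le (C := (a + 1) + (1 + 2 / (a + 1 + 1))) ha (fun w hw => ?_)
      (by linarith)
    have h1 := key (a + 1) (by linarith) w hw
    rw [show a + 1 + 1 = a + 2 by ring] at h1 ⊢
    have hF1 := besselSeries_pos (a := a + 1) (by linarith) hw
    have hF2 := besselSeries_pos (a := a + 2) (by linarith) hw
    have hsw := Real.sqrt_nonneg w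
    have h2 : besselSeries a w ≤
        ((a + 1) + (1 + 2 / (a + 2))) * (besselSeries (a + 1) w * (1 + √w)) := by
      rw [besselSeries_recurrence ha]
      have e : w = √w * √w := (Real.mul_self_sqrt hw).symm
      -- Writing `w` as `√w * √w` lets one root be absorbed by `key` at order `a + 1`, so the
      -- recurrence also bounds order `a` from above.
      have h3 : w * besselSeries (a + 2) w ≤ √w * (besselSeries (a + 2) w * (1 + √w)) := by
        have := mul_nonneg hsw hF2.le
        calc w * besselSeries (a + 2) w = √w * √w * besselSeries (a + 2) w := by rw [← e]
          _ ≤ _ := by nlinarith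
      have h4 := mul_le_mul_of_nonneg_left h1 hsw
      have h5 : 0 < 1 + 2 / (a + 2) := by
        have : 0 < 2 / (a + 2) := div_pos two_pos (by linarith)
        linarith
      nlinarith [mul_nonneg (mul_nonneg (by linarith : (0:ℝ) ≤ a + 1) hF1.le) hsw, mul_pos h5 hF1]
    rw [weightedBessel, weightedBessel, Real.rpow_add_one (hw1 w).ne']
    nlinarith [mul_le_mul_of_nonneg_right h2 (Real.rpow_nonneg (hw1 w).le a)]

/-- Hölder interpolates between orders `a` and `a + 1`, the weights interpolate exactly, and order
`a + 1` is already comparable to order `a`. -/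
lemma weightedBessel_add_isBigO {a s : ℝ} (ha : -1 < a) (hs₀ : 0 ≤ s) (hs₁ : s ≤ 1) :
    weightedBessel (a + s) =O[𝓟 (Ici 0)] weightedBessel a := by
  rcases hs₀.eq_or_lt with rfl | hs₀
  · rw [add_zero]
  rcases hs₁.eq_or_lt with rfl | hs₁
  · exact (weightedBessel_add_one_isTheta ha).1
  have ha1 : -1 < a + 1 := by linarith
  have h1 : weightedBessel (a + s) =O[𝓟 (Ici 0)]
      fun w => weightedBessel a w ^ (1 - s) * weightedBessel (a + 1) w ^ s := by
    refine isBigO_principal.2 ⟨1 + 1 / (a + 1), fun w hw => ?_⟩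
    have hA := weightedBessel_pos ha hw
    have hB := weightedBessel_pos ha1 hw
    have hw1 : 0 < 1 + √w := by positivity
    have h0 : 0 < a + 1 := by linarith
    rw [Real.norm_of_nonneg (weightedBessel_pos (by linarith) hw).le,
      Real.norm_of_nonneg (by positivity)]
    have h := besselSeries_le_rpow_mul_rpow (p := a) (q := a + 1) (s := a + s) (θ := s)
      (K := 1 + 1 / (a + 1)) ha ha1 (by linarith) hs₀.le hs₁.le (by positivity) (fun m => ?_) hw
    · simp only [weightedBessel]
      rw [Real.mul_rpow (besselSeries_pos ha hw).le (by positivity),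
        Real.mul_rpow (besselSeries_pos ha1 hw).le (by positivity), ← Real.rpow_mul hw1.le,
        ← Real.rpow_mul hw1.le, mul_mul_mul_comm, ← Real.rpow_add hw1,
        show a * (1 - s) + (a + 1) * s = a + s by ring, ← mul_assoc]
      exact mul_le_mul_of_nonneg_right h (by positivity)
    · have hm := m.cast_nonneg (α := ℝ)
      have hb : 0 < (m : ℝ) + a + 1 := by linarith
      have := Gamma_rpow_mul_Gamma_add_one_rpow_le hb hs₀ hs₁
      rw [show (m : ℝ) + (a + 1) + 1 = m + a + 1 + 1 by ring,
        show (m : ℝ) + (a + s) + 1 = m + a + 1 + s by ring]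
      refine this.trans ?_
      have hG : 0 < Real.Gamma (m + a + 1 + s) := Real.Gamma_pos_of_pos (by linarith)
      gcongr
      linarith
  have h2 := ((isBigO_refl (weightedBessel a) (𝓟 (Ici 0))).rpow (r := 1 - s) (by linarith)
    (weightedBessel_nonneg_eventually ha)).mul
    ((weightedBessel_add_one_isTheta ha).1.rpow (r := s) hs₀.le
      (weightedBessel_nonneg_eventually ha))
  refine (h1.trans h2).congr' (EventuallyEq.refl _ _) (eventually_principal.2 fun w hw => ?_)
  have := weightedBessel_pos ha hw
  simp only
  rw [← Real.rpow_add this, sub_add_cancel, Real.rpow_one]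

/-- The lower bound is the upper bound for the remaining step from `a + s` to `a + 1`. -/
lemma weightedBessel_add_isTheta {a s : ℝ} (ha : -1 < a) (hs₀ : 0 ≤ s) (hs₁ : s ≤ 1) :
    weightedBessel (a + s) =Θ[𝓟 (Ici 0)] weightedBessel a := by
  refine ⟨weightedBessel_add_isBigO ha hs₀ hs₁, (weightedBessel_add_one_isTheta ha).2.trans ?_⟩
  have := weightedBessel_add_isBigO (a := a + s) (s := 1 - s) (by linarith) (by linarith)
    (by linarith)
  rwa [show a + s + (1 - s) = a + 1 by ring] at this

lemma weightedBessel_isTheta {a b : ℝ} (ha : -1 < a) (hb : -1 < b) :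
    weightedBessel b =Θ[𝓟 (Ici 0)] weightedBessel a := by
  wlog hab : a ≤ b generalizing a b
  · exact (this hb ha (le_of_not_ge hab)).symm
  have hn : ∀ n : ℕ, weightedBessel (a + n) =Θ[𝓟 (Ici 0)] weightedBessel a := by
    intro n
    induction n with
    | zero => simpa using isTheta_refl (weightedBessel a) (𝓟 (Ici 0))
    | succ n ih =>
      have := weightedBessel_add_one_isTheta (a := a + n)
        (by have := n.cast_nonneg (α := ℝ); linarith)
      rw [Nat.cast_add_one, ← add_assoc]
      exact this.trans ih
  have h1 := Nat.floor_le (sub_nonneg.2 hab)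
  have h2 := (Nat.lt_floor_add_one (b - a)).le
  have := weightedBessel_add_isTheta (a := a + ⌊b - a⌋₊) (s := b - a - ⌊b - a⌋₊)
    (by have := (⌊b - a⌋₊).cast_nonneg (α := ℝ); linarith) (by linarith) (by linarith)
  rw [show a + ⌊b - a⌋₊ + (b - a - ⌊b - a⌋₊) = b by ring] at this
  exact this.trans (hn _)

/-- Uniform two-sided log-linearity of `besselSeries` in the order. -/
theorem exists_besselSeries_comparison {b g l : ℝ} (hb : -1 < b) (hg : -1 < g) (hl₀ : 0 < l)
    (hl₁ : l < 1) :
    ∃ c C : ℝ, 0 < c ∧ 0 < C ∧ ∀ w, 0 ≤ w →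
      c * (besselSeries b w ^ l * besselSeries g w ^ (1 - l)) ≤
          besselSeries (l * b + (1 - l) * g) w ∧
        besselSeries (l * b + (1 - l) * g) w ≤
          C * (besselSeries b w ^ l * besselSeries g w ^ (1 - l)) := by
  set a := l * b + (1 - l) * g with hadef
  have ha : -1 < a := by nlinarith
  have hθ : (fun w => weightedBessel b w ^ l * weightedBessel g w ^ (1 - l))
      =Θ[𝓟 (Ici 0)] weightedBessel a := by
    have h := ((weightedBessel_isTheta ha hb).rpow (r := l)
      (weightedBessel_nonneg_eventually hb) (weightedBessel_nonneg_eventually ha)).mul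
      ((weightedBessel_isTheta ha hg).rpow (r := 1 - l)
      (weightedBessel_nonneg_eventually hg) (weightedBessel_nonneg_eventually ha))
    refine h.trans_eventuallyEq (eventually_principal.2 fun w hw => ?_)
    simp only
    rw [← Real.rpow_add (weightedBessel_pos ha hw), add_sub_cancel, Real.rpow_one]
  obtain ⟨C₁, hC₁, h₁⟩ := hθ.1.exists_pos
  obtain ⟨C₂, hC₂, h₂⟩ := hθ.2.exists_pos
  refine ⟨C₁⁻¹, C₂, inv_pos.2 hC₁, hC₂, fun w hw => ?_⟩
  have h₁' := eventually_principal.1 h₁.bound w hw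
  have h₂' := eventually_principal.1 h₂.bound w hw
  have hA := weightedBessel_pos ha hw
  have hB := weightedBessel_pos hb hw
  have hG := weightedBessel_pos hg hw
  have hw1 : 0 < 1 + √w := by positivity
  -- The exponents of `1 + √w` average to `a`, so the same weight stands on both sides and cancels.
  have e : weightedBessel b w ^ l * weightedBessel g w ^ (1 - l) =
      besselSeries b w ^ l * besselSeries g w ^ (1 - l) * (1 + √w) ^ a := by
    simp only [weightedBessel]
    rw [Real.mul_rpow (besselSeries_pos hb hw).le (by positivity),
      Real.mul_rpow (besselSeries_pos hg hw).le (by positivity), ← Real.rpow_mul hw1.le,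
      ← Real.rpow_mul hw1.le, mul_mul_mul_comm, ← Real.rpow_add hw1, hadef]
    ring_nf
  have hp : 0 < (1 + √w) ^ a := by positivity
  have hp' : 0 < weightedBessel b w ^ l * weightedBessel g w ^ (1 - l) := by positivity
  rw [Real.norm_of_nonneg hA.le, Real.norm_of_nonneg hp'.le, e, weightedBessel, ← mul_assoc] at h₁' h₂'
  refine ⟨?_, le_of_mul_le_mul_right h₂' hp⟩
  rw [inv_mul_le_iff₀ hC₁]
  exact le_of_mul_le_mul_right h₁' hp

/-! ### Comparison of the heat kernels. -/

lemma exists_heatFactor_comparison {b g l : ℝ} (hb : -1 < b) (hg : -1 < g) (hl₀ : 0 < l)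
    (hl₁ : l < 1) :
    ∃ c C : ℝ, 0 < c ∧ 0 < C ∧ ∀ t, 0 < t → ∀ x y : ℝ,
      c * (heatFactor b t x y ^ l * heatFactor g t x y ^ (1 - l)) ≤
          heatFactor (l * b + (1 - l) * g) t x y ∧
        heatFactor (l * b + (1 - l) * g) t x y ≤
          C * (heatFactor b t x y ^ l * heatFactor g t x y ^ (1 - l)) := by
  obtain ⟨c, C, hc, hC, h⟩ := exists_besselSeries_comparison hb hg hl₀ hl₁
  refine ⟨c, C, hc, hC, fun t ht x y => ?_⟩
  have h1 := one_sub_exp_pos ht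
  have hw : 0 ≤ x ^ 2 * y ^ 2 * Real.exp (-4 * t) / (1 - Real.exp (-4 * t)) ^ 2 := by positivity
  obtain ⟨hl, hu⟩ := h _ hw
  have hFb := besselSeries_pos hb hw
  have hFg := besselSeries_pos hg hw
  simp only [heatFactor]
  set w := x ^ 2 * y ^ 2 * Real.exp (-4 * t) / (1 - Real.exp (-4 * t)) ^ 2
  set A := Real.exp (-2 * t) / (1 - Real.exp (-4 * t)) with hA
  set B := 2 * Real.exp (-(x ^ 2 + y ^ 2) / 2) *
      Real.exp (-(x ^ 2 + y ^ 2) * Real.exp (-4 * t) / (1 - Real.exp (-4 * t))) with hB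
  have hAp : 0 < A := by positivity
  have hBp : 0 < B := by positivity
  have e : (A ^ (b + 1) * B * besselSeries b w) ^ l *
      (A ^ (g + 1) * B * besselSeries g w) ^ (1 - l) =
      A ^ (l * b + (1 - l) * g + 1) * B * (besselSeries b w ^ l * besselSeries g w ^ (1 - l)) := by
    have e1 : A ^ (l * b + (1 - l) * g + 1) = (A ^ (b + 1)) ^ l * (A ^ (g + 1)) ^ (1 - l) := by
      rw [← Real.rpow_mul hAp.le, ← Real.rpow_mul hAp.le, ← Real.rpow_add hAp]
      ring_nf
    have e2 : B ^ l * B ^ (1 - l) = B := by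
      rw [← Real.rpow_add hBp, add_sub_cancel, Real.rpow_one]
    rw [Real.mul_rpow (by positivity) hFb.le, Real.mul_rpow (by positivity) hFg.le,
      Real.mul_rpow (by positivity) hBp.le, Real.mul_rpow (by positivity) hBp.le, e1]
    linear_combination ((A ^ (b + 1)) ^ l * (A ^ (g + 1)) ^ (1 - l) *
      (besselSeries b w ^ l * besselSeries g w ^ (1 - l))) * e2
  rw [e]
  have hp : 0 < A ^ (l * b + (1 - l) * g + 1) * B := by positivity
  constructor
  · rw [mul_left_comm]
    exact mul_le_mul_of_nonneg_left hl hp.le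
  · rw [mul_left_comm C]
    exact mul_le_mul_of_nonneg_left hu hp.le

theorem exists_heatKernel_comparison {d : ℕ} {α β γ : Fin d → ℝ} (hβ : ∀ i, -1 < β i)
    (hγ : ∀ i, -1 < γ i) {l : ℝ} (hl₀ : 0 < l) (hl₁ : l < 1)
    (hα : ∀ i, α i = l * β i + (1 - l) * γ i) :
    ∃ c C : ℝ, 0 < c ∧ 0 < C ∧ ∀ t, 0 < t → ∀ x y : Fin d → ℝ,
      c * (heatKernel β t x y ^ l * heatKernel γ t x y ^ (1 - l)) ≤ heatKernel α t x y ∧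
        heatKernel α t x y ≤ C * (heatKernel β t x y ^ l * heatKernel γ t x y ^ (1 - l)) := by
  have hα' : ∀ i, -1 < α i := fun i => by rw [hα]; nlinarith [hβ i, hγ i]
  choose c C hc hC h using fun i => exists_heatFactor_comparison (hβ i) (hγ i) hl₀ hl₁
  refine ⟨∏ i, c i, ∏ i, C i, Finset.prod_pos fun i _ => hc i, Finset.prod_pos fun i _ => hC i,
    fun t ht x y => ?_⟩
  have hb := fun i => heatFactor_pos (hβ i) ht (x i) (y i)
  have hg := fun i => heatFactor_pos (hγ i) ht (x i) (y i)
  rw [heatKernel_eq hα' ht, heatKernel_eq hβ ht, heatKernel_eq hγ ht,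
    ← Real.finsetProd_rpow _ _ (fun i _ => (hb i).le),
    ← Real.finsetProd_rpow _ _ (fun i _ => (hg i).le), ← Finset.prod_mul_distrib,
    ← Finset.prod_mul_distrib, ← Finset.prod_mul_distrib]
  simp only [hα]
  constructor
  · refine Finset.prod_le_prod (fun i _ => ?_) fun i _ => (h i t ht _ _).1
    have := hb i; have := hg i; have := hc i
    positivity
  · refine Finset.prod_le_prod (fun i _ => ?_) fun i _ => (h i t ht _ _).2
    rw [← hα]
    exact (heatFactor_pos (hα' i) ht _ _).le

/-! ### Measurability and the potential kernels. -/

lemma measurable_besselSeries {a : ℝ} (ha : -1 < a) : Measurable (besselSeries a) := by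
  refine measurable_of_tendsto_metrizable
    (f := fun n w => ∑ m ∈ Finset.range n, w ^ m / (m.factorial * Real.Gamma (m + a + 1)))
    (fun n => by fun_prop) (tendsto_pi_nhds.2 fun w => ?_)
  exact (summable_besselSeries ha w).hasSum.tendsto_sum_nat

lemma measurable_prod_heatFactor {d : ℕ} {δ : Fin d → ℝ} (hδ : ∀ i, -1 < δ i) (x : Fin d → ℝ) :
    Measurable fun p : ℝ × (Fin d → ℝ) => ∏ i, heatFactor (δ i) p.1 (x i) (p.2 i) := by
  refine Finset.measurable_fun_prod _ fun i _ => ?_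
  have := measurable_besselSeries (hδ i)
  unfold heatFactor
  refine Measurable.mul (by fun_prop) (this.comp (by fun_prop))

/-- The closed form is available because only `t > 0` enters; it is jointly measurable in `(t, y)`,
which makes the potential kernel measurable in `y`. -/
lemma potentialKernel_eq {d : ℕ} {δ : Fin d → ℝ} (hδ : ∀ i, -1 < δ i) (σ : ℝ)
    (x y : Fin d → ℝ) :
    potentialKernel δ σ x y = ENNReal.ofReal (1 / Real.Gamma σ) * ∫⁻ t in Ioi (0 : ℝ),
      ENNReal.ofReal ((∏ i, heatFactor (δ i) t (x i) (y i)) * t ^ (σ - 1)) := by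
  rw [potentialKernel]
  congr 1
  refine setLIntegral_congr_fun measurableSet_Ioi fun t ht => ?_
  simp only [heatKernel_eq hδ ht]

lemma measurable_potentialKernel {d : ℕ} {δ : Fin d → ℝ} (hδ : ∀ i, -1 < δ i) (σ : ℝ)
    (x : Fin d → ℝ) : Measurable (potentialKernel δ σ x) := by
  have h : potentialKernel δ σ x = fun y => ENNReal.ofReal (1 / Real.Gamma σ) *
      ∫⁻ t in Ioi (0 : ℝ),
        ENNReal.ofReal ((∏ i, heatFactor (δ i) t (x i) (y i)) * t ^ (σ - 1)) :=
    funext fun y => potentialKernel_eq hδ σ x y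
  rw [h]
  have hm := measurable_prod_heatFactor hδ x
  refine Measurable.const_mul ?_ _
  exact Measurable.lintegral_prod_left'
    (f := fun p : ℝ × (Fin d → ℝ) =>
      ENNReal.ofReal ((∏ i, heatFactor (δ i) p.1 (x i) (p.2 i)) * p.1 ^ (σ - 1))) (by fun_prop)

theorem exists_potentialKernel_le {d : ℕ} {α β γ : Fin d → ℝ} (hβ : ∀ i, -1 < β i)
    (hγ : ∀ i, -1 < γ i) {l : ℝ} (hl₀ : 0 < l) (hl₁ : l < 1)
    (hα : ∀ i, α i = l * β i + (1 - l) * γ i) {σ σ₁ σ₂ : ℝ} (hσ₁ : 0 < σ₁) (hσ₂ : 0 < σ₂)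
    (hσ : σ = l * σ₁ + (1 - l) * σ₂) :
    ∃ C : ℝ, 0 < C ∧ ∀ x y : Fin d → ℝ, potentialKernel α σ x y ≤ ENNReal.ofReal C *
      (potentialKernel β σ₁ x y ^ l * potentialKernel γ σ₂ x y ^ (1 - l)) := by
  obtain ⟨c, C, -, hC, h⟩ := exists_heatKernel_comparison hβ hγ hl₀ hl₁ hα
  have hl₂ : 0 < 1 - l := by linarith
  have hσ₀ : 0 < σ := by rw [hσ]; positivity
  have hG := Real.Gamma_pos_of_pos hσ₀
  have hG₁ := Real.Gamma_pos_of_pos hσ₁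
  have hG₂ := Real.Gamma_pos_of_pos hσ₂
  -- The Gamma factors convert the normalisations `1 / Γ(σ₁)` and `1 / Γ(σ₂)` into `1 / Γ(σ)`.
  refine ⟨C / Real.Gamma σ * (Real.Gamma σ₁ ^ l * Real.Gamma σ₂ ^ (1 - l)), by positivity,
    fun x y => ?_⟩
  have hmeas : ∀ {δ : Fin d → ℝ} (_ : ∀ i, -1 < δ i) (s : ℝ), AEMeasurable
      (fun t => ENNReal.ofReal (heatKernel δ t x y * t ^ (s - 1))) (volume.restrict (Ioi 0)) := by
    intro δ hδ s
    have hm : Measurable fun t : ℝ => ∏ i, heatFactor (δ i) t (x i) (y i) :=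
      Measurable.comp (g := fun p : ℝ × (Fin d → ℝ) => ∏ i, heatFactor (δ i) p.1 (x i) (p.2 i))
        (f := fun t => (t, y)) (measurable_prod_heatFactor hδ x) (by fun_prop)
    refine AEMeasurable.congr (f := fun t => ENNReal.ofReal
      ((∏ i, heatFactor (δ i) t (x i) (y i)) * t ^ (s - 1))) (by fun_prop) ?_
    filter_upwards [ae_restrict_mem measurableSet_Ioi] with t ht
    rw [heatKernel_eq hδ ht]
  have key : ∫⁻ t in Ioi (0 : ℝ), ENNReal.ofReal (heatKernel α t x y * t ^ (σ - 1)) ≤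
      ENNReal.ofReal C *
        ((∫⁻ t in Ioi (0 : ℝ), ENNReal.ofReal (heatKernel β t x y * t ^ (σ₁ - 1))) ^ l *
        (∫⁻ t in Ioi (0 : ℝ), ENNReal.ofReal (heatKernel γ t x y * t ^ (σ₂ - 1))) ^ (1 - l)) := by
    calc _ ≤ ∫⁻ t in Ioi (0 : ℝ), ENNReal.ofReal C *
          (ENNReal.ofReal (heatKernel β t x y * t ^ (σ₁ - 1)) ^ l *
            ENNReal.ofReal (heatKernel γ t x y * t ^ (σ₂ - 1)) ^ (1 - l)) := by
          refine setLIntegral_mono' measurableSet_Ioi fun t (ht : 0 < t) => ?_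
          have hb := heatKernel_pos hβ ht x y
          have hg := heatKernel_pos hγ ht x y
          rw [ENNReal.ofReal_rpow_of_nonneg (by positivity) hl₀.le,
            ENNReal.ofReal_rpow_of_nonneg (by positivity) hl₂.le,
            ← ENNReal.ofReal_mul (by positivity), ← ENNReal.ofReal_mul hC.le]
          refine ENNReal.ofReal_le_ofReal ?_
          have e : t ^ (σ - 1) = (t ^ (σ₁ - 1)) ^ l * (t ^ (σ₂ - 1)) ^ (1 - l) := by
            rw [← Real.rpow_mul ht.le, ← Real.rpow_mul ht.le, ← Real.rpow_add ht, hσ]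
            ring_nf
          rw [Real.mul_rpow hb.le (by positivity), Real.mul_rpow hg.le (by positivity),
            mul_mul_mul_comm, ← e, ← mul_assoc]
          exact mul_le_mul_of_nonneg_right (h t ht x y).2 (by positivity)
      _ = ENNReal.ofReal C * ∫⁻ t in Ioi (0 : ℝ),
          (ENNReal.ofReal (heatKernel β t x y * t ^ (σ₁ - 1)) ^ l *
            ENNReal.ofReal (heatKernel γ t x y * t ^ (σ₂ - 1)) ^ (1 - l)) :=
          lintegral_const_mul' _ _ ENNReal.ofReal_ne_top
      _ ≤ _ := by
          gcongr
          exact ENNReal.lintegral_mul_norm_pow_le (hmeas hβ σ₁) (hmeas hγ σ₂) hl₀.le hl₂.le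
            (by ring)
  simp only [potentialKernel]
  rw [ENNReal.mul_rpow_of_nonneg _ _ hl₀.le, ENNReal.mul_rpow_of_nonneg _ _ hl₂.le,
    ENNReal.ofReal_rpow_of_nonneg (by positivity) hl₀.le,
    ENNReal.ofReal_rpow_of_nonneg (by positivity) hl₂.le, mul_mul_mul_comm, ← mul_assoc,
    ← ENNReal.ofReal_mul (by positivity), ← ENNReal.ofReal_mul (by positivity)]
  refine (mul_le_mul_right key _).trans_eq ?_
  rw [← mul_assoc, ← ENNReal.ofReal_mul (by positivity)]
  congr 2
  rw [Real.div_rpow one_pos.le hG₁.le, Real.div_rpow one_pos.le hG₂.le, Real.one_rpow,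
    Real.one_rpow]
  have := Real.rpow_pos_of_pos hG₁ l
  have := Real.rpow_pos_of_pos hG₂ (1 - l)
  field_simp

/-! ### The potential operators. -/

lemma measurableSet_orthant (d : ℕ) : MeasurableSet (orthant d) := by
  have : orthant d = Set.univ.pi fun _ => Ioi (0 : ℝ) := by ext; simp [orthant]
  rw [this]
  exact MeasurableSet.univ_pi fun _ => measurableSet_Ioi

/-- The three operators integrate against different measures; moving the densities into the
integrands makes Hölder's inequality applicable over one common measure. Finiteness of the density
replaces measurability of `f`. -/
lemma potential_eq {d : ℕ} (δ : Fin d → ℝ) (σ : ℝ) (f : (Fin d → ℝ) → ℝ) (x : Fin d → ℝ) :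
    potential δ σ f x = ∫⁻ y in orthant d, ENNReal.ofReal (∏ i, y i ^ (2 * δ i + 1)) *
      (potentialKernel δ σ x y * ENNReal.ofReal (f y)) := by
  rw [potential, mu, lintegral_withDensity_eq_lintegral_mul_non_measurable _ (by fun_prop)
    (Eventually.of_forall fun _ => ENNReal.ofReal_lt_top)]
  rfl

theorem potential_le_of_potentialKernel_le {d : ℕ} {α β γ : Fin d → ℝ} (hβ : ∀ i, -1 < β i)
    (hγ : ∀ i, -1 < γ i) {l : ℝ} (hl₀ : 0 < l) (hl₁ : l < 1)
    (hα : ∀ i, α i = l * β i + (1 - l) * γ i) {σ σ₁ σ₂ : ℝ} {x : Fin d → ℝ} {C : ℝ}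
    (h : ∀ y, potentialKernel α σ x y ≤ ENNReal.ofReal C *
      (potentialKernel β σ₁ x y ^ l * potentialKernel γ σ₂ x y ^ (1 - l)))
    {f f₁ f₂ : (Fin d → ℝ) → ℝ} (hm₁ : AEMeasurable f₁ (volume.restrict (orthant d)))
    (hm₂ : AEMeasurable f₂ (volume.restrict (orthant d))) (hf₁ : ∀ y ∈ orthant d, 0 ≤ f₁ y)
    (hf₂ : ∀ y ∈ orthant d, 0 ≤ f₂ y)
    (hf : ∀ y ∈ orthant d, f y = f₁ y ^ l * f₂ y ^ (1 - l)) :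
    potential α σ f x ≤ ENNReal.ofReal C *
      (potential β σ₁ f₁ x ^ l * potential γ σ₂ f₂ x ^ (1 - l)) := by
  have hl₂ : 0 < 1 - l := by linarith
  have hK₁ := measurable_potentialKernel hβ σ₁ x
  have hK₂ := measurable_potentialKernel hγ σ₂ x
  have hw : ∀ δ : Fin d → ℝ,
      Measurable fun y : Fin d → ℝ => ENNReal.ofReal (∏ i, y i ^ (2 * δ i + 1)) := by
    fun_prop
  have hm₁' : AEMeasurable (fun y => ENNReal.ofReal (∏ i, y i ^ (2 * β i + 1)) *
      (potentialKernel β σ₁ x y * ENNReal.ofReal (f₁ y))) (volume.restrict (orthant d)) :=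
    (hw β).aemeasurable.mul (hK₁.aemeasurable.mul hm₁.ennreal_ofReal)
  have hm₂' : AEMeasurable (fun y => ENNReal.ofReal (∏ i, y i ^ (2 * γ i + 1)) *
      (potentialKernel γ σ₂ x y * ENNReal.ofReal (f₂ y))) (volume.restrict (orthant d)) :=
    (hw γ).aemeasurable.mul (hK₂.aemeasurable.mul hm₂.ennreal_ofReal)
  rw [potential_eq, potential_eq, potential_eq]
  refine le_trans ?_ (mul_le_mul_right
    (ENNReal.lintegral_mul_norm_pow_le hm₁' hm₂' hl₀.le hl₂.le (by ring)) _)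
  rw [← lintegral_const_mul' _ _ ENNReal.ofReal_ne_top]
  refine setLIntegral_mono' (measurableSet_orthant d) fun y hy => ?_
  have e1 : ENNReal.ofReal (∏ i, y i ^ (2 * α i + 1)) =
      ENNReal.ofReal (∏ i, y i ^ (2 * β i + 1)) ^ l *
        ENNReal.ofReal (∏ i, y i ^ (2 * γ i + 1)) ^ (1 - l) := by
    have hp : ∀ δ : Fin d → ℝ, ∀ i, 0 ≤ y i ^ (2 * δ i + 1) := fun δ i =>
      Real.rpow_nonneg (hy i).le _
    have hp' : ∀ δ : Fin d → ℝ, 0 ≤ ∏ i, y i ^ (2 * δ i + 1) := fun δ =>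
      Finset.prod_nonneg fun i _ => hp δ i
    rw [ENNReal.ofReal_rpow_of_nonneg (hp' β) hl₀.le,
      ENNReal.ofReal_rpow_of_nonneg (hp' γ) hl₂.le,
      ← ENNReal.ofReal_mul (Real.rpow_nonneg (hp' β) _),
      ← Real.finsetProd_rpow _ _ (fun i _ => hp β i),
      ← Real.finsetProd_rpow _ _ (fun i _ => hp γ i), ← Finset.prod_mul_distrib]
    congr 1
    refine Finset.prod_congr rfl fun i _ => ?_
    rw [← Real.rpow_mul (hy i).le, ← Real.rpow_mul (hy i).le, ← Real.rpow_add (hy i), hα]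
    ring_nf
  have e2 : ENNReal.ofReal (f y) =
      ENNReal.ofReal (f₁ y) ^ l * ENNReal.ofReal (f₂ y) ^ (1 - l) := by
    rw [hf y hy, ENNReal.ofReal_rpow_of_nonneg (hf₁ y hy) hl₀.le,
      ENNReal.ofReal_rpow_of_nonneg (hf₂ y hy) hl₂.le,
      ← ENNReal.ofReal_mul (Real.rpow_nonneg (hf₁ y hy) _)]
  simp only [ENNReal.mul_rpow_of_nonneg _ _ hl₀.le, ENNReal.mul_rpow_of_nonneg _ _ hl₂.le]
  rw [e1, e2]
  calc _ ≤ ENNReal.ofReal (∏ i, y i ^ (2 * β i + 1)) ^ l *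
        ENNReal.ofReal (∏ i, y i ^ (2 * γ i + 1)) ^ (1 - l) *
        (ENNReal.ofReal C * (potentialKernel β σ₁ x y ^ l * potentialKernel γ σ₂ x y ^ (1 - l)) *
          (ENNReal.ofReal (f₁ y) ^ l * ENNReal.ofReal (f₂ y) ^ (1 - l))) := by
        gcongr
        exact h y
    _ = _ := by ring

end Laguerre

theorem proposition5p1 (d : ℕ) (β γ : Fin d → ℝ)
    (hβ : ∀ i, -1 < β i) (hγ : ∀ i, -1 < γ i) (hβγ : β ≠ γ)
    (σ₁ σ₂ : ℝ) (hσ₁ : 0 < σ₁) (hσ₂ : 0 < σ₂)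
    (l : ℝ) (hl₀ : 0 < l) (hl₁ : l < 1)
    (α : Fin d → ℝ) (hα : ∀ i, α i = l * β i + (1 - l) * γ i)
    (σ : ℝ) (hσ : σ = l * σ₁ + (1 - l) * σ₂) :
    -- the three heat kernels are given by convergent series with positive sums
    (∀ δ : Fin d → ℝ, δ = α ∨ δ = β ∨ δ = γ → ∀ t : ℝ, 0 < t →
      ∀ x ∈ Laguerre.orthant d, ∀ y ∈ Laguerre.orthant d,
        Summable (Laguerre.heatTerm δ t x y) ∧ 0 < Laguerre.heatKernel δ t x y) ∧
    -- two-sided comparison of the heat kernels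
    (∃ c C : ℝ, 0 < c ∧ 0 < C ∧ ∀ t : ℝ, 0 < t →
      ∀ x ∈ Laguerre.orthant d, ∀ y ∈ Laguerre.orthant d,
        c * (Laguerre.heatKernel β t x y ^ l * Laguerre.heatKernel γ t x y ^ (1 - l))
            ≤ Laguerre.heatKernel α t x y ∧
          Laguerre.heatKernel α t x y
            ≤ C * (Laguerre.heatKernel β t x y ^ l * Laguerre.heatKernel γ t x y ^ (1 - l))) ∧
    -- the potential kernels
    (∃ C : ℝ, 0 < C ∧ ∀ x ∈ Laguerre.orthant d, ∀ y ∈ Laguerre.orthant d,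
      Laguerre.potentialKernel α σ x y ≤ ENNReal.ofReal C *
        (Laguerre.potentialKernel β σ₁ x y ^ l * Laguerre.potentialKernel γ σ₂ x y ^ (1 - l))) ∧
    -- the potential operators
    (∃ C : ℝ, 0 < C ∧ ∀ f f₁ f₂ : (Fin d → ℝ) → ℝ,
      AEMeasurable f₁ (volume.restrict (Laguerre.orthant d)) →
      AEMeasurable f₂ (volume.restrict (Laguerre.orthant d)) →
      (∀ y ∈ Laguerre.orthant d, 0 ≤ f₁ y) → (∀ y ∈ Laguerre.orthant d, 0 ≤ f₂ y) →
      (∀ y ∈ Laguerre.orthant d, f y = f₁ y ^ l * f₂ y ^ (1 - l)) →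
      ∀ x ∈ Laguerre.orthant d,
        Laguerre.potential α σ f x ≤ ENNReal.ofReal C *
          (Laguerre.potential β σ₁ f₁ x ^ l * Laguerre.potential γ σ₂ f₂ x ^ (1 - l))) := by

  have hα' : ∀ i, -1 < α i := fun i => by rw [hα]; nlinarith [hβ i, hγ i]
  obtain ⟨C, hC, hK⟩ := Laguerre.exists_potentialKernel_le hβ hγ hl₀ hl₁ hα hσ₁ hσ₂ hσ
  -- Hölder in `y` has constant `1`, so the kernel constant also serves the operators.
  refine ⟨?_, ?_, ⟨C, hC, fun x _ y _ => hK x y⟩, ⟨C, hC, ?_⟩⟩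
  · intro δ hδ t ht x _ y _
    have hδ' : ∀ i, -1 < δ i := by rcases hδ with rfl | rfl | rfl <;> assumption
    exact ⟨(Laguerre.hasSum_heatTerm hδ' ht x y).summable, Laguerre.heatKernel_pos hδ' ht x y⟩
  · obtain ⟨c, C, hc, hC, h⟩ := Laguerre.exists_heatKernel_comparison hβ hγ hl₀ hl₁ hα
    exact ⟨c, C, hc, hC, fun t ht x _ y _ => h t ht x y⟩
  · intro f f₁ f₂ hm₁ hm₂ hf₁ hf₂ hf x _
    exact Laguerre.potential_le_of_potentialKernel_le hβ hγ hl₀ hl₁ hα (hK x) hm₁ hm₂ hf₁ hf₂ hf
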